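/- All toposes are taken over the category of (small) sets. A Grothendieck topos is a category equivalent to the category $\mathrm{Sh}(\mathcal C,J)$ of sheaves of sets on a small site. For a Grothendieck topos $\mathcal T$ let $\mathrm{Ab}(\mathcal T)$ be the category of abelian group objects of $\mathcal T$; it is an abelian category with enough injectives. For an object $B$ of $\mathcal T$ and $q \ge 0$ let $H^q(\mathcal T,B;-)$ be the $q$-th right derived functor of the left exact functor $\mathrm{Hom}_{\mathcal T}(B,-)\colon \mathrm{Ab}(\mathcal T)\to \mathrm{Ab}$. An object $F$ of $\mathrm{Ab}(\mathcal T)$ is called flabby if $H^q(\mathcal T,B;F)=0$ for all $q>0$ and all objects $B$ of $\mathcal T$. Let $f\colon \mathcal F\to\mathcal E$ be a geometric morphism between Grothendieck toposes, that is, a functor $f_*\colon\mathcal F\to\mathcal E$ together with a left adjoint $f^*\colon\mathcal E\to\mathcal F$ that preserves finite limits. Let $R^qf_*\colon \mathrm{Ab}(\mathcal F)\to\mathrm{Ab}(\mathcal E)$ denote the $q$-th right derived functor of the left exact functor $\mathrm{Ab}(\mathcal F)\to\mathrm{Ab}(\mathcal E)$ induced by $f_*$. If $F\in\mathrm{Ab}(\mathcal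 F)$ is flabby, then $$R^qf_*(F)=0\quad\text{for all } q>0,$$ that is, $F$ is $f_*$-acyclic. -/

import Mathlib

open CategoryTheory Limits MonoidalCategory CartesianMonoidalCategory Opposite

universe w u u₁ u₂ v

noncomputable section

namespace ToposCohomology

/-! ### Abelian group objects form a preadditive category -/

section CommGrp

open scoped MonObj

variable {C : Type u} [Category.{v} C] [CartesianMonoidalCategory C] [BraidedCategory C]

/-- Homomorphisms of abelian group objects form an abelian group: the sum of `f` and `g` is
their product in the group `Hom(A, B)` given by the group structure of `B`. -/
instance homAddCommGroup (A B : CommGrp C) : AddCommGroup (A ⟶ B) :=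
  Equiv.addCommGroup (β := Additive (A.toGrp ⟶ B.toGrp))
    (InducedCategory.homEquiv.trans Additive.ofMul)

theorem hom_add {A B : CommGrp C} (f g : A ⟶ B) :
    (f + g).hom.hom.hom = f.hom.hom.hom * g.hom.hom.hom := rfl

instance commGrpPreadditive : Preadditive (CommGrp C) where
  add_comp A B D f f' g := by
    apply CommGrp.hom_ext
    rw [hom_add]
    change (f.hom.hom.hom * f'.hom.hom.hom) ≫ g.hom.hom.hom = _
    rw [MonObj.mul_comp]
    rfl
  comp_add A B D f g g' := by
    apply CommGrp.hom_ext
    rw [hom_add]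
    change f.hom.hom.hom ≫ (g.hom.hom.hom * g'.hom.hom.hom) = _
    rw [MonObj.comp_mul]
    rfl

/-- The functor `Hom(B, -)` from abelian group objects to abelian groups. -/
def homFunctor (B : C) : CommGrp C ⥤ AddCommGrpCat.{v} where
  obj G := AddCommGrpCat.of (Additive (B ⟶ G.X))
  map {G H} φ := AddCommGrpCat.ofHom (MonoidHom.toAdditive
    { toFun := fun s => s ≫ φ.hom.hom.hom
      map_one' := MonObj.one_comp φ.hom.hom.hom
      map_mul' := fun s t => MonObj.mul_comp s t φ.hom.hom.hom })
  map_id G := by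
    refine AddCommGrpCat.hom_ext (AddMonoidHom.ext fun s => ?_)
    exact Category.comp_id (X := B) (Y := G.X) (Additive.toMul s)
  map_comp {G H K} φ ψ := by
    refine AddCommGrpCat.hom_ext (AddMonoidHom.ext fun s => ?_)
    exact (Category.assoc (Additive.toMul s) φ.hom.hom.hom ψ.hom.hom.hom).symm

instance homFunctor_additive (B : C) : (homFunctor B).Additive where
  map_add {G H φ ψ} := by
    refine AddCommGrpCat.hom_ext (AddMonoidHom.ext fun s => ?_)
    exact MonObj.comp_mul (Additive.toMul s) φ.hom.hom.hom ψ.hom.hom.hom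

instance mapCommGrp_additive {D : Type u₁} [Category.{w} D] [CartesianMonoidalCategory D]
    [BraidedCategory D] (F : C ⥤ D) [F.Braided] : F.mapCommGrp.Additive where
  map_add {G H φ ψ} := by
    apply CommGrp.hom_ext
    exact Functor.map_mul F φ.hom.hom.hom ψ.hom.hom.hom

end CommGrp

/-! ### Grothendieck toposes

A Grothendieck topos is a category equivalent to the category of sheaves of sets on a small site.
-/

/-- The category `E` is equivalent to `Sh(C, J)` for some small site `(C, J)`. -/
class IsGrothendieckTopos (E : Type u) [Category.{w} E] : Prop where
  exists_site : ∃ (C : Type w) (_ : SmallCategory C) (J : GrothendieckTopology C),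
    Nonempty (E ≌ Sheaf J (Type w))

/-! ### Abelian group objects of a Grothendieck topos are sheaves of abelian groups -/

section Comparison

open scoped MonObj

variable {E : Type u} [Category.{w} E]
variable {C : Type w} [SmallCategory C] {J : GrothendieckTopology C} (e : E ≌ Sheaf J (Type w))

/-- The object of the topos given by the sheaf associated to a representable presheaf. -/
def canonicalFunctor : C ⥤ E := yoneda ⋙ presheafToSheaf J (Type w) ⋙ e.inverse

/-- The adjunction between presheaves on the site and the topos. -/
def siteAdjunction : presheafToSheaf J (Type w) ⋙ e.inverse ⊣ e.functor ⋙ sheafToPresheaf J _ :=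
  (sheafificationAdjunction J (Type w)).comp e.symm.toAdjunction

/-- Maps out of the sheaf associated to `Hom(-, U)` are sections over `U`. -/
def sectionsEquiv (U : C) (Z : E) :
    ((canonicalFunctor e).obj U ⟶ Z) ≃ (e.functor.obj Z).obj.obj (op U) :=
  ((siteAdjunction e).homEquiv (yoneda.obj U) Z).trans yonedaEquiv

theorem sectionsEquiv_comp {U : C} {Y Z : E} (t : (canonicalFunctor e).obj U ⟶ Y) (g : Y ⟶ Z) :
    sectionsEquiv e U Z (t ≫ g) = (e.functor.map g).hom.app (op U) (sectionsEquiv e U Y t) :=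
  congrArg yonedaEquiv ((siteAdjunction e).homEquiv_naturality_right (X := yoneda.obj U) t g)

theorem sectionsEquiv_precomp {U V : C} {Z : E} (h : V ⟶ U) (t : (canonicalFunctor e).obj U ⟶ Z) :
    sectionsEquiv e V Z ((canonicalFunctor e).map h ≫ t) =
      (e.functor.obj Z).obj.map h.op (sectionsEquiv e U Z t) :=
  (congrArg yonedaEquiv
    ((siteAdjunction e).homEquiv_naturality_left (yoneda.map h) t)).trans
      (yonedaEquiv_naturality _ h).symm

theorem canonicalFunctor_hom_ext {Y Z : E} {g g' : Y ⟶ Z}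
    (h : ∀ (U : C) (t : (canonicalFunctor e).obj U ⟶ Y), t ≫ g = t ≫ g') : g = g' := by
  apply e.functor.map_injective
  apply Sheaf.hom_ext
  ext U x
  obtain ⟨t, rfl⟩ := (sectionsEquiv e U.unop Y).surjective x
  have := congrArg (sectionsEquiv e U.unop Z) (h U.unop t)
  rwa [sectionsEquiv_comp, sectionsEquiv_comp] at this

/-- The object of the topos underlying a sheaf of abelian groups. -/
def underlying : Sheaf J AddCommGrpCat.{w} ⥤ E :=
  sheafCompose J (forget AddCommGrpCat) ⋙ e.inverse

/-- The free abelian group functor of the topos. -/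
def freeAb : E ⥤ Sheaf J AddCommGrpCat.{w} :=
  e.functor ⋙ Sheaf.composeAndSheafify J AddCommGrpCat.free

/-- The free abelian group functor is left adjoint to the forgetful functor. -/
def freeAbAdj : freeAb e ⊣ underlying e :=
  e.toAdjunction.comp (Sheaf.adjunction J AddCommGrpCat.adj)

/-- Maps from `l(U)` to the underlying object of `P` are sections of `P` over `U`. -/
def underlyingSections (U : C) (P : Sheaf J AddCommGrpCat.{w}) :
    ((canonicalFunctor e).obj U ⟶ (underlying e).obj P) ≃ P.obj.obj (op U) :=
  (sectionsEquiv e U _).trans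
    (((sheafToPresheaf J (Type w) ⋙ (evaluation _ _).obj (op U)).mapIso
      (e.counitIso.app ((sheafCompose J (forget AddCommGrpCat)).obj P))).toEquiv)

theorem underlyingSections_comp {U : C} {P Q : Sheaf J AddCommGrpCat.{w}}
    (t : (canonicalFunctor e).obj U ⟶ (underlying e).obj P) (g : P ⟶ Q) :
    underlyingSections e U Q (t ≫ (underlying e).map g) =
      (g.hom.app (op U)).hom (underlyingSections e U P t) := by
  have h1 := sectionsEquiv_comp e t ((underlying e).map g)
  have h2 := congrArg (fun k => k.hom.app (op U) (sectionsEquiv e U _ t))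
    (e.counit.naturality ((sheafCompose J (forget AddCommGrpCat)).map g))
  exact (congrArg ((e.counit.app ((sheafCompose J (forget AddCommGrpCat)).obj Q)).hom.app (op U))
    h1).trans h2

theorem underlyingSections_precomp {U V : C} {P : Sheaf J AddCommGrpCat.{w}} (h : V ⟶ U)
    (t : (canonicalFunctor e).obj U ⟶ (underlying e).obj P) :
    underlyingSections e V P ((canonicalFunctor e).map h ≫ t) =
      (P.obj.map h.op).hom (underlyingSections e U P t) := by
  have h1 := sectionsEquiv_precomp e h t
  have h2 := congrArg (fun k => k (sectionsEquiv e U _ t))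
    ((e.counit.app ((sheafCompose J (forget AddCommGrpCat)).obj P)).hom.naturality h.op)
  exact (congrArg ((e.counit.app ((sheafCompose J (forget AddCommGrpCat)).obj P)).hom.app (op V))
    h1).trans h2

theorem underlyingSections_eq {U : C} {P : Sheaf J AddCommGrpCat.{w}}
    (t : (canonicalFunctor e).obj U ⟶ (underlying e).obj P) :
    underlyingSections e U P t = ((((freeAbAdj e).homEquiv _ P).symm t).hom.app (op U)).hom
      (underlyingSections e U _ ((freeAbAdj e).unit.app ((canonicalFunctor e).obj U))) := by
  refine Eq.trans ?_ (underlyingSections_comp e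
    ((freeAbAdj e).unit.app ((canonicalFunctor e).obj U)) (((freeAbAdj e).homEquiv _ P).symm t))
  exact congrArg (underlyingSections e U P) (((freeAbAdj e).homEquiv_unit _ _ _).symm.trans
    (((freeAbAdj e).homEquiv _ P).apply_symm_apply t)).symm

variable [CartesianMonoidalCategory E] [BraidedCategory E]

/-- The presheaf of abelian groups `U ↦ Hom(l(U), G)` of an abelian group object `G`. -/
def sectionsPresheaf (G : CommGrp E) : Cᵒᵖ ⥤ AddCommGrpCat.{w} where
  obj U := (homFunctor ((canonicalFunctor e).obj U.unop)).obj G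
  map {U V} h := AddCommGrpCat.ofHom (MonoidHom.toAdditive
    { toFun := fun s => (canonicalFunctor e).map h.unop ≫ s
      map_one' := MonObj.comp_one _
      map_mul' := fun s t => MonObj.comp_mul _ s t })
  map_id U := by
    refine AddCommGrpCat.hom_ext (AddMonoidHom.ext fun s => ?_)
    exact (congrArg (fun k => k ≫ (show (canonicalFunctor e).obj U.unop ⟶ G.X from s))
      ((canonicalFunctor e).map_id U.unop)).trans (Category.id_comp _)
  map_comp {U V W} h k := by
    refine AddCommGrpCat.hom_ext (AddMonoidHom.ext fun s => ?_)
    change (canonicalFunctor e).map (k.unop ≫ h.unop) ≫ Additive.toMul s =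
      (canonicalFunctor e).map k.unop ≫ (canonicalFunctor e).map h.unop ≫ Additive.toMul s
    simp

/-- The underlying presheaf of sets of `U ↦ Hom(l(U), G)` is the sheaf corresponding to `G`. -/
def sectionsPresheafForget (G : CommGrp E) :
    sectionsPresheaf e G ⋙ forget AddCommGrpCat ≅ (e.functor.obj G.X).obj :=
  NatIso.ofComponents (fun U => (sectionsEquiv e U.unop G.X).toIso) (fun {U V} h => by
    ext s
    exact sectionsEquiv_precomp e h.unop _)

/-- The functor sending an abelian group object to the corresponding sheaf of abelian groups. -/
def toSheafAb : CommGrp E ⥤ Sheaf J AddCommGrpCat.{w} where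
  obj G := ⟨sectionsPresheaf e G, by
    rw [Presheaf.isSheaf_iff_isSheaf_forget J _ (forget AddCommGrpCat)]
    exact (Presheaf.isSheaf_of_iso_iff (sectionsPresheafForget e G)).2
      (e.functor.obj G.X).property⟩
  map {G H} φ := ⟨{
    app := fun U => (homFunctor ((canonicalFunctor e).obj U.unop)).map φ
    naturality := fun U V h => by
      refine AddCommGrpCat.hom_ext (AddMonoidHom.ext fun s => ?_)
      exact Category.assoc _ (Additive.toMul s) φ.hom.hom.hom }⟩
  map_id G := by
    apply Sheaf.hom_ext
    ext U : 2
    exact (homFunctor ((canonicalFunctor e).obj U.unop)).map_id G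
  map_comp φ ψ := by
    apply Sheaf.hom_ext
    ext U : 2
    exact (homFunctor ((canonicalFunctor e).obj U.unop)).map_comp φ ψ

instance toSheafAb_faithful : (toSheafAb e).Faithful where
  map_injective {G H φ ψ} h := by
    apply CommGrp.hom_ext
    refine canonicalFunctor_hom_ext e fun U t => ?_
    have := congrArg (fun k => k.hom.app (op U)) h
    exact congrArg (fun k => k.hom (Additive.ofMul t)) this

/-- A map of underlying objects that is multiplicative on sections is a homomorphism. -/
theorem exists_hom_of_sections {G H : CommGrp E} (g : G.X ⟶ H.X)
    (hg : ∀ (U : C) (s t : (canonicalFunctor e).obj U ⟶ G.X),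
      (s * t) ≫ g = (s ≫ g) * (t ≫ g)) :
    ∃ φ : G ⟶ H, φ.hom.hom.hom = g := by
  have hmul : MonObj.mul (X := G.X) ≫ g = (g ⊗ₘ g) ≫ MonObj.mul (X := H.X) := by
    refine canonicalFunctor_hom_ext e fun U t => ?_
    have h := hg U (t ≫ fst _ _) (t ≫ snd _ _)
    rw [Hom.mul_def, Hom.mul_def] at h
    have ht : lift (t ≫ fst G.X G.X) (t ≫ snd G.X G.X) = t := by
      rw [← comp_lift, lift_fst_snd, Category.comp_id]
    have ht' : lift ((t ≫ fst G.X G.X) ≫ g) ((t ≫ snd G.X G.X) ≫ g) = t ≫ (g ⊗ₘ g) := by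
      rw [← lift_map, ht]
    rw [ht, ht'] at h
    simpa using h
  have hone : MonObj.one (X := G.X) ≫ g = MonObj.one (X := H.X) := by
    have h := congrArg (fun k => lift (1 : 𝟙_ E ⟶ G.X) 1 ≫ k) hmul
    simp only [lift_map_assoc] at h
    rw [← Category.assoc, ← Hom.mul_def, ← Hom.mul_def, mul_one] at h
    rw [MonObj.one_eq_one, MonObj.one_eq_one]
    exact left_eq_mul.1 h
  exact ⟨InducedCategory.homMk (Grp.homMk'' g hone hmul), rfl⟩

instance toSheafAb_full : (toSheafAb e).Full where
  map_surjective {G H} ψ := by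
    let ψ' : (e.functor.obj G.X).obj ⟶ (e.functor.obj H.X).obj :=
      (sectionsPresheafForget e G).inv ≫ Functor.whiskerRight ψ.hom (forget AddCommGrpCat) ≫
        (sectionsPresheafForget e H).hom
    let g : G.X ⟶ H.X := e.functor.preimage ⟨ψ'⟩
    have key : ∀ (U : C) (t : (canonicalFunctor e).obj U ⟶ G.X),
        t ≫ g = Additive.toMul ((ψ.hom.app (op U)).hom (Additive.ofMul t)) := by
      intro U t
      apply (sectionsEquiv e U H.X).injective
      rw [sectionsEquiv_comp, Functor.map_preimage]
      change (sectionsEquiv e U H.X) ((ψ.hom.app (op U)).hom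
        ((sectionsEquiv e U G.X).symm (sectionsEquiv e U G.X t))) = _
      rw [Equiv.symm_apply_apply]
      rfl
    obtain ⟨φ, hφ⟩ := exists_hom_of_sections e g (fun U s t => by
      rw [key, key, key]
      exact congrArg Additive.toMul ((ψ.hom.app (op U)).hom.map_add (Additive.ofMul s)
        (Additive.ofMul t)))
    refine ⟨φ, ?_⟩
    apply Sheaf.hom_ext
    ext U : 2
    refine AddCommGrpCat.hom_ext (AddMonoidHom.ext fun s => ?_)
    change Additive.ofMul (Additive.toMul s ≫ φ.hom.hom.hom) = _
    rw [hφ]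
    exact key U.unop (Additive.toMul s)

/-- The presheaf of groups on the topos represented by a sheaf of abelian groups. -/
def homPresheaf (P : Sheaf J AddCommGrpCat.{w}) : Eᵒᵖ ⥤ CommGrpCat.{w} :=
  (freeAb e).op ⋙ preadditiveYoneda.obj P ⋙ AddCommGrpCat.toCommGrp

/-- The underlying object represents this presheaf. -/
def homPresheafRepresentable (P : Sheaf J AddCommGrpCat.{w}) :
    (homPresheaf e P ⋙ forget CommGrpCat).RepresentableBy ((underlying e).obj P) where
  homEquiv := ((freeAbAdj e).homEquiv _ P).symm
  homEquiv_comp f g := (freeAbAdj e).homEquiv_naturality_left_symm f g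

instance underlyingCommGrpObj (P : Sheaf J AddCommGrpCat.{w}) :
    CommGrpObj ((underlying e).obj P) :=
  CommGrpObj.ofRepresentableBy _ (homPresheaf e P) (homPresheafRepresentable e P)

theorem underlying_mul (P : Sheaf J AddCommGrpCat.{w}) {Y : E} (s t : Y ⟶ (underlying e).obj P) :
    ((freeAbAdj e).homEquiv Y P).symm (s * t) =
      ((freeAbAdj e).homEquiv Y P).symm s + ((freeAbAdj e).homEquiv Y P).symm t := by
  have hμ : MonObj.mul (X := (underlying e).obj P) = (freeAbAdj e).homEquiv _ P
      (((freeAbAdj e).homEquiv _ P).symm (fst _ _) +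
        ((freeAbAdj e).homEquiv _ P).symm (snd _ _)) := rfl
  rw [Hom.mul_def, hμ, Adjunction.homEquiv_naturality_left_symm, Equiv.symm_apply_apply,
    Preadditive.comp_add, ← Adjunction.homEquiv_naturality_left_symm,
    ← Adjunction.homEquiv_naturality_left_symm, lift_fst, lift_snd]

theorem underlyingSections_mul {U : C} {P : Sheaf J AddCommGrpCat.{w}}
    (s t : (canonicalFunctor e).obj U ⟶ (underlying e).obj P) :
    underlyingSections e U P (s * t) = underlyingSections e U P s + underlyingSections e U P t := by
  rw [underlyingSections_eq, underlyingSections_eq e s, underlyingSections_eq e t, underlying_mul]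
  rfl

instance toSheafAb_essSurj : (toSheafAb e).EssSurj where
  mem_essImage P := by
    let i : ((toSheafAb e).obj ⟨(underlying e).obj P⟩).obj ≅ P.obj :=
      NatIso.ofComponents (fun U => AddEquiv.toAddCommGrpIso
        { toEquiv := Additive.toMul.trans (underlyingSections e U.unop P)
          map_add' := fun s t => underlyingSections_mul e (Additive.toMul s) (Additive.toMul t) })
        (fun {U V} h => by
          refine AddCommGrpCat.hom_ext (AddMonoidHom.ext fun s => ?_)
          exact underlyingSections_precomp e h.unop (Additive.toMul s))
    exact ⟨⟨(underlying e).obj P⟩, ⟨(fullyFaithfulSheafToPresheaf J _).preimageIso i⟩⟩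

instance toSheafAb_isEquivalence : (toSheafAb e).IsEquivalence where

end Comparison

/-! ### `Ab(E)` is an abelian category with enough injectives -/

section Abelian

variable {E : Type u} [Category.{w} E] [CartesianMonoidalCategory E] [BraidedCategory E]

theorem commGrp_exists_equivalence (E : Type u) [Category.{w} E] [CartesianMonoidalCategory E]
    [BraidedCategory E] [IsGrothendieckTopos E] :
    ∃ (C : Type w) (_ : SmallCategory C) (J : GrothendieckTopology C)
      (Φ : CommGrp E ⥤ Sheaf J AddCommGrpCat.{w}), Φ.IsEquivalence := by
  obtain ⟨C, hC, J, ⟨e⟩⟩ := IsGrothendieckTopos.exists_site (E := E)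
  exact ⟨C, hC, J, toSheafAb e, inferInstance⟩

instance commGrp_hasFiniteProducts [IsGrothendieckTopos E] : HasFiniteProducts (CommGrp E) := by
  obtain ⟨C, _, J, Φ, _⟩ := commGrp_exists_equivalence E
  exact ⟨fun n => Adjunction.hasLimitsOfShape_of_equivalence Φ⟩

theorem commGrp_abelian_aux [IsGrothendieckTopos E] :
    IsNormalMonoCategory (CommGrp E) ∧ IsNormalEpiCategory (CommGrp E) ∧
      HasKernels (CommGrp E) ∧ HasCokernels (CommGrp E) := by
  obtain ⟨C, _, J, Φ, _⟩ := commGrp_exists_equivalence E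
  let A : Abelian (CommGrp E) := abelianOfEquivalence Φ
  exact ⟨A.toIsNormalMonoCategory, A.toIsNormalEpiCategory, A.has_kernels, A.has_cokernels⟩

instance commGrpAbelian [IsGrothendieckTopos E] : Abelian (CommGrp E) where
  toPreadditive := commGrpPreadditive
  toIsNormalMonoCategory := commGrp_abelian_aux.1
  toIsNormalEpiCategory := commGrp_abelian_aux.2.1
  has_kernels := commGrp_abelian_aux.2.2.1
  has_cokernels := commGrp_abelian_aux.2.2.2

instance commGrp_enoughInjectives [IsGrothendieckTopos E] : EnoughInjectives (CommGrp E) := by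
  obtain ⟨C, _, J, Φ, _⟩ := commGrp_exists_equivalence E
  exact EnoughInjectives.of_equivalence Φ

end Abelian

/-! ### Cohomology, flabby objects and higher direct images -/

section Cohomology

variable {E : Type u} [Category.{w} E] [CartesianMonoidalCategory E] [BraidedCategory E]
  [IsGrothendieckTopos E]

/-- `H^q(E, B; F)`: the right derived functors of `Hom(B, -) : Ab(E) ⥤ Ab`. -/
def cohomology (q : ℕ) (B : E) : CommGrp E ⥤ AddCommGrpCat.{w} := (homFunctor B).rightDerived q

/-- An abelian group object `F` is flabby if `H^q(E, B; F) = 0` for all `q > 0` and all `B`. -/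
def IsFlabby (F : CommGrp E) : Prop :=
  ∀ q : ℕ, 0 < q → ∀ B : E, IsZero ((cohomology q B).obj F)

end Cohomology

/-- A geometric morphism `F → E`: a direct image functor with a left exact left adjoint. -/
structure GeometricMorphism (F : Type u₁) [Category.{w} F] (E : Type u₂) [Category.{w} E] where
  /-- the direct image functor -/
  directImage : F ⥤ E
  /-- the inverse image functor -/
  inverseImage : E ⥤ F
  /-- the inverse image is left adjoint to the direct image -/
  adj : inverseImage ⊣ directImage
  /-- the inverse image is left exact -/
  preservesFiniteLimits : PreservesFiniteLimits inverseImage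

namespace GeometricMorphism

variable {F : Type u₁} [Category.{w} F] [CartesianMonoidalCategory F] [BraidedCategory F]
variable {E : Type u₂} [Category.{w} E] [CartesianMonoidalCategory E] [BraidedCategory E]

/-- The direct image preserves finite products, hence is (uniquely) a cartesian functor. -/
instance directImageBraided (f : GeometricMorphism F E) : f.directImage.Braided :=
  haveI : PreservesLimitsOfSize.{0, 0} f.directImage := f.adj.rightAdjoint_preservesLimits
  .ofChosenFiniteProducts _

/-- The direct image on abelian group objects, `f_* : Ab(F) ⥤ Ab(E)`. -/
def directImageAb (f : GeometricMorphism F E) : CommGrp F ⥤ CommGrp E :=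
  f.directImage.mapCommGrp

instance directImageAb_additive (f : GeometricMorphism F E) : f.directImageAb.Additive :=
  mapCommGrp_additive f.directImage

/-- The higher direct images `R^q f_* : Ab(F) ⥤ Ab(E)`. -/
def higherDirectImage [IsGrothendieckTopos F] [IsGrothendieckTopos E]
    (f : GeometricMorphism F E) (q : ℕ) : CommGrp F ⥤ CommGrp E :=
  f.directImageAb.rightDerived q

end GeometricMorphism

end ToposCohomology

end

/-!
By adjunction `Hom(f^* B, I) ≅ Hom(B, f_* I)` for every abelian group object `I`. Applied to an
injective resolution `I` of `F`, this says that the sections over `B` of the complex `f_* I` compute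
`H^q(f^* B, F)`, so this complex of sections is exact in degree `q` as soon as that group vanishes.
When this holds for all `B` in a site of definition of the target, `f_* I` is an exact complex of
presheaves in degree `q`, hence, sheafification being exact, an exact complex of sheaves; that is,
`R^q f_* F = 0`.
-/

namespace ToposCohomology

theorem isZero_rightDerived_obj_iff_exact_map_sc {A : Type u₁} [Category.{w} A] [Abelian A]
    [HasInjectiveResolutions A] {D : Type u₂} [Category.{v} D] [Abelian D] {X : A}
    (I : InjectiveResolution X) (R : A ⥤ D) [R.Additive] (n : ℕ) :
    IsZero ((R.rightDerived n).obj X) ↔ ((I.cocomplex.sc n).map R).Exact :=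
  (I.isoRightDerivedObj R n).isZero_iff.trans
    (HomologicalComplex.exactAt_iff_isZero_homology _ n).symm

section Exactness

theorem exact_of_exact_map_rightAdjoint {A : Type u₁} [Category.{w} A] [HasZeroMorphisms A]
    {D : Type u₂} [Category.{v} D] [HasZeroMorphisms D] {L : D ⥤ A} {R : A ⥤ D} (adj : L ⊣ R)
    [R.Full] [R.Faithful] [R.PreservesZeroMorphisms] [L.PreservesZeroMorphisms]
    [L.PreservesHomology] {S : ShortComplex A} (hS : (S.map R).Exact) : S.Exact :=
  ShortComplex.exact_of_iso (S.mapNatIso (asIso adj.counit)) (hS.map L)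

theorem exact_iff_forall_exact_map_evaluation {K : Type u₁} [Category.{w} K] {A : Type u₂}
    [Category.{v} A] [Abelian A] (S : ShortComplex (K ⥤ A)) :
    S.Exact ↔ ∀ k : K, (S.map ((evaluation K A).obj k)).Exact := by
  simp only [ShortComplex.exact_iff_isZero_homology, Functor.isZero_iff]
  exact forall_congr' fun k => (S.mapHomologyIso ((evaluation K A).obj k)).isZero_iff.symm

variable {E : Type u} [Category.{w} E] [CartesianMonoidalCategory E] [BraidedCategory E]
  [IsGrothendieckTopos E]
variable {C : Type w} [SmallCategory C] {J : GrothendieckTopology C} (e : E ≌ Sheaf J (Type w))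

theorem exact_of_forall_exact_map_homFunctor_canonicalFunctor {S : ShortComplex (CommGrp E)}
    (hS : ∀ U : C, (S.map (homFunctor ((canonicalFunctor e).obj U))).Exact) : S.Exact := by
  have presheaf_exact : ((S.map (toSheafAb e)).map (sheafToPresheaf J AddCommGrpCat.{w})).Exact :=
    (exact_iff_forall_exact_map_evaluation _).2 fun U => hS U.unop
  have sheaf_exact : (S.map (toSheafAb e)).Exact :=
    exact_of_exact_map_rightAdjoint (sheafificationAdjunction J AddCommGrpCat.{w}) presheaf_exact
  exact (S.exact_map_iff_of_faithful (toSheafAb e)).1 sheaf_exact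

end Exactness

section Adjunction

open scoped Obj MonObj

variable {F : Type u₁} [Category.{w} F] [CartesianMonoidalCategory F]
variable {E : Type u₂} [Category.{w} E] [CartesianMonoidalCategory E]
variable {L : E ⥤ F} {R : F ⥤ E} (adj : L ⊣ R)

/-- The bijection `Hom(L B, M) ≃ Hom(B, R M)` of an adjunction `L ⊣ R`, for a monoid object `M`, as
an isomorphism of monoids. -/
noncomputable def homMulEquiv [R.Monoidal] (B : E) (M : F) [MonObj M] :
    (L.obj B ⟶ M) ≃* (B ⟶ R.obj M) where
  toEquiv := adj.homEquiv B M
  map_mul' s t := by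
    simp only [Equiv.toFun_as_coe, Adjunction.homEquiv_unit, Functor.map_mul, MonObj.comp_mul]

variable [BraidedCategory F] [BraidedCategory E] [R.Braided]

/-- For an adjunction `L ⊣ R`, sections of `R G` over `B` are sections of `G` over `L B`, naturally
in the abelian group object `G`. -/
noncomputable def homFunctorObjIso (B : E) : homFunctor (L.obj B) ≅ R.mapCommGrp ⋙ homFunctor B :=
  NatIso.ofComponents
    (fun G => (MulEquiv.toAdditive (homMulEquiv adj B G.X)).toAddCommGrpIso)
    (fun φ => AddCommGrpCat.hom_ext <| AddMonoidHom.ext fun s =>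
      adj.homEquiv_naturality_right (Additive.toMul s) φ.hom.hom.hom)

end Adjunction

end ToposCohomology

open ToposCohomology in
theorem mainTheorem10_general
    {𝓕 : Type u₁} [Category.{w} 𝓕] [CartesianMonoidalCategory 𝓕] [BraidedCategory 𝓕]
    [IsGrothendieckTopos 𝓕]
    {𝓔 : Type u₂} [Category.{w} 𝓔] [CartesianMonoidalCategory 𝓔] [BraidedCategory 𝓔]
    [IsGrothendieckTopos 𝓔]
    {C : Type w} [SmallCategory C] {J : GrothendieckTopology C} (e : 𝓔 ≌ Sheaf J (Type w))
    {L : 𝓔 ⥤ 𝓕} {R : 𝓕 ⥤ 𝓔} (adj : L ⊣ R) [R.Braided] (F : CommGrp 𝓕) (q : ℕ)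
    (hF : ∀ U : C, IsZero ((cohomology q (L.obj ((canonicalFunctor e).obj U))).obj F)) :
    IsZero ((R.mapCommGrp.rightDerived q).obj F) := by
  let I := injectiveResolution F
  rw [isZero_rightDerived_obj_iff_exact_map_sc I]
  refine exact_of_forall_exact_map_homFunctor_canonicalFunctor e fun U => ?_
  have sections_exact := (isZero_rightDerived_obj_iff_exact_map_sc I _ q).1 (hF U)
  exact ShortComplex.exact_of_iso ((I.cocomplex.sc q).mapNatIso (homFunctorObjIso adj _))
    sections_exact

theorem mainTheorem10
    {𝓕 : Type u₁} [Category.{w} 𝓕] [CartesianMonoidalCategory 𝓕] [BraidedCategory 𝓕]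
    [ToposCohomology.IsGrothendieckTopos 𝓕]
    {𝓔 : Type u₂} [Category.{w} 𝓔] [CartesianMonoidalCategory 𝓔] [BraidedCategory 𝓔]
    [ToposCohomology.IsGrothendieckTopos 𝓔]
    (f : ToposCohomology.GeometricMorphism 𝓕 𝓔)
    (F : CommGrp 𝓕) (hF : ToposCohomology.IsFlabby F) (q : ℕ) (hq : 0 < q) :
    IsZero ((f.higherDirectImage q).obj F) := by
  obtain ⟨C, _, J, ⟨e⟩⟩ := ToposCohomology.IsGrothendieckTopos.exists_site (E := 𝓔)
  exact mainTheorem10_general e f.adj F q fun _ => hF q hq _
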